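/- Let $\mathcal X\subset\mathbb R^d$, let $\lambda$ be a sigma-finite Borel measure on $\mathcal X$ with $\lambda(\mathcal X)\neq 0$, let $s:\mathcal X\to\mathbb R^k$ be Borel measurable, and put $\kappa(\theta)=\log\int_{\mathcal X}\exp(\theta^{T}s(x))\,d\lambda(x)\in(-\infty,\infty]$ for $\theta\in\mathbb R^k$. Let $\Theta=\{\theta\in\mathbb R^k:\kappa(\theta)<\infty\}$, and for $\theta\in\Theta$ let $P_\theta$ be the probability measure on $\mathcal X$ with density $p_\theta(x)=\exp(\theta^{T}s(x)-\kappa(\theta))$ with respect to $\lambda$. Assume that $\Theta$ is nonempty and open and that $P_\theta\neq P_{\theta'}$ whenever $\theta\neq\theta'$ in $\Theta$. Let $\mathcal M=\{\int s\,dP_\theta:\theta\in\Theta\}\subset\mathbb R^k$ be the moment space. Let $\xi\in\mathbb R^k$ and $\nu>0$ be such that $\xi/\nu\in\mathcal M$, and let $$\pi_{\xi,\nu}(\theta)=\exp\big(\xi^{T}\theta-\nu\kappa(\theta)-\psi(\xi,\nu)\big)\,I(\theta\in\Theta),\qquad \psi(\xi,\nu)=\log\int_\Theta\exp\big(\xi^{T}\theta-\nu\kappa(\theta)\big)\,d\theta,$$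 be the density of the conjugate prior. For $x_1,\dots,x_n\in\mathcal X$ and $J\subset\{1,\dots,n\}$ put $x_J=(x_j:j\in J)$ and $$m(x_J)=\int_\Theta\Big(\prod_{j\in J}p_\theta(x_j)\Big)\pi_{\xi,\nu}(\theta)\,d\theta,\qquad \mu_{x_J}=\frac{\xi+\sum_{j\in J}s(x_j)}{\nu+|J|},$$ and write $m(x_{1:n})=m(x_{\{1,\dots,n\}})$. Then for every compact $U\subset\mathcal M$ there exists $C\in(0,\infty)$ such that the following holds. For every $n\in\{1,2,\dots\}$, if $A\subset\{1,\dots,n\}$ and $B=\{1,\dots,n\}\setminus A$ are nonempty, and $x_1,\dots,x_n\in\mathcal X$ satisfy $\frac1{|A|}\sum_{j\in A}s(x_j)\in U$ and $\mu_{x_B}\in U$, then $m(x_A)$ and $m(x_B)$ are positive and finite, and $$\frac{m(x_{1:n})}{m(x_A)\,m(x_B)}\le C\Big(\frac{ab}{\nu+n}\Big)^{k/2},\qquad a=\nu+|A|,\quad b=\nu+|B|.$$ -/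

import Mathlib

open MeasureTheory
open scoped ENNReal RealInnerProductSpace

noncomputable section

/-- The data of a `k`-dimensional exponential family on a set `𝒳 ⊆ ℝᵈ`: a nonzero sigma-finite
Borel measure `lam` on `𝒳`, a Borel measurable sufficient statistics function `s : 𝒳 → ℝᵏ`, and a
parameter set `Θ ⊆ ℝᵏ`. -/
structure ExpFamily (d k : ℕ) where
  /-- The sample space. -/
  carrier : Set (EuclideanSpace ℝ (Fin d))
  /-- The base measure. -/
  lam : Measure carrier
  sigmaFinite_lam : SigmaFinite lam
  lam_univ_ne_zero : lam Set.univ ≠ 0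
  /-- The sufficient statistics function. -/
  s : carrier → EuclideanSpace ℝ (Fin k)
  measurable_s : Measurable s
  /-- The parameter set. -/
  Θ : Set (EuclideanSpace ℝ (Fin k))

namespace ExpFamily

variable {d k : ℕ} (F : ExpFamily d k)

/-- `κ(θ) = log ∫ exp(θᵀ s(x)) dλ(x)`, as an extended real number. -/
def kappa (θ : EuclideanSpace ℝ (Fin k)) : EReal :=
  ENNReal.log (∫⁻ x, ENNReal.ofReal (Real.exp ⟪θ, F.s x⟫) ∂F.lam)

/-- `p_θ(x) = exp(θᵀ s(x) - κ(θ))`; only meaningful where `κ(θ)` is finite. -/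
def density (θ : EuclideanSpace ℝ (Fin k)) (x : F.carrier) : ℝ :=
  Real.exp (⟪θ, F.s x⟫ - (F.kappa θ).toReal)

/-- The measure `P_θ` with density `p_θ` with respect to `λ`. -/
def P (θ : EuclideanSpace ℝ (Fin k)) : Measure F.carrier :=
  F.lam.withDensity fun x => ENNReal.ofReal (F.density θ x)

/-- The regularity conditions: the family is full, nonempty, regular and identifiable. -/
structure IsRegular : Prop where
  full : F.Θ = {θ | F.kappa θ < ⊤}
  nonempty : F.Θ.Nonempty
  isOpen : IsOpen F.Θ
  identifiable : ∀ θ ∈ F.Θ, ∀ θ' ∈ F.Θ, θ ≠ θ' → F.P θ ≠ F.P θ'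

/-- The moment space `{E_θ s(X) : θ ∈ Θ}`. -/
def momentSpace : Set (EuclideanSpace ℝ (Fin k)) :=
  {μ | ∃ θ ∈ F.Θ, μ = ∫ x, F.s x ∂(F.P θ)}

/-- The set `Ξ` of hyperparameters `(ξ, ν)` of the conjugate prior. -/
def hyperparameters : Set (EuclideanSpace ℝ (Fin k) × ℝ) :=
  {q | 0 < q.2 ∧ q.2⁻¹ • q.1 ∈ F.momentSpace}

/-- `ψ(ξ, ν) = log ∫_Θ exp(ξᵀ θ - ν κ(θ)) dθ`, as an extended real number. -/
def psi (ξ : EuclideanSpace ℝ (Fin k)) (ν : ℝ) : EReal :=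
  ENNReal.log (∫⁻ θ in F.Θ, ENNReal.ofReal (Real.exp (⟪ξ, θ⟫ - ν * (F.kappa θ).toReal)))

open Classical in
/-- The conjugate prior density `π_{ξ,ν}` with respect to Lebesgue measure on `ℝᵏ`. -/
def prior (ξ : EuclideanSpace ℝ (Fin k)) (ν : ℝ) (θ : EuclideanSpace ℝ (Fin k)) : ℝ :=
  if θ ∈ F.Θ then Real.exp (⟪ξ, θ⟫ - ν * (F.kappa θ).toReal - (F.psi ξ ν).toReal) else 0

/-- An exponential family with conjugate prior is well-behaved if it satisfies the regularity
conditions and the hyperparameters `(ξ, ν)` lie in `Ξ`. -/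
structure WellBehaved (ξ : EuclideanSpace ℝ (Fin k)) (ν : ℝ) : Prop where
  regular : F.IsRegular
  mem_hyperparameters : (ξ, ν) ∈ F.hyperparameters

/-- The marginal density `m(x_J) = ∫_Θ (∏_{j ∈ J} p_θ(x_j)) π_{ξ,ν}(θ) dθ`, with values
in `[0, ∞]`. -/
def marginal (ξ : EuclideanSpace ℝ (Fin k)) (ν : ℝ) {n : ℕ} (x : Fin n → F.carrier)
    (J : Finset (Fin n)) : ℝ≥0∞ :=
  ∫⁻ θ in F.Θ, ENNReal.ofReal ((∏ j ∈ J, F.density θ (x j)) * F.prior ξ ν θ)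

/-- `μ_{x_J} = (ξ + ∑_{j ∈ J} s(x_j)) / (ν + |J|)`. -/
def posteriorMean (ξ : EuclideanSpace ℝ (Fin k)) (ν : ℝ) {n : ℕ} (x : Fin n → F.carrier)
    (J : Finset (Fin n)) : EuclideanSpace ℝ (Fin k) :=
  (ν + (J.card : ℝ))⁻¹ • (ξ + ∑ j ∈ J, F.s (x j))

end ExpFamily

end

/-! Each marginal is a constant times a Laplace integral with exponent `T (⟪u, θ⟫ - κ θ)`. For `u`
in the moment space this exponent equals `T κ*(u) - T D(θ_u, θ)`, where `θ_u` is the parameter with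
mean `u`, `κ*` is the convex conjugate and `D` is the Bregman divergence of `κ`. Uniformly over base
points in a compact set, `D` is at most quadratic nearby (`exists_bregman_le`), and at least
quadratic near and linear far away (`exists_le_bregman`). Hence the integral is of order `T^(-k/2)
exp(T κ*(u))` uniformly for `u ∈ U` and `T ≥ 1` (`exists_lintegral_le`, `exists_le_lintegral`).

With `p = |A|`, `u` the plain average over `A`, and `w = μ_{x_B}`, the exponent for the full sample
is `p (⟪u, θ⟫ - κ) + b (⟪w, θ⟫ - κ)`. The term of smaller weight is bounded by its supremum, and the
Laplace bound is applied to the other, whose weight is at least `(p + b) / 2`. For `A` the prior is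
treated as a fixed continuous weight, so that the conjugate factor is again `exp(p κ*(u))`. The
exponential factors then cancel in the ratio, leaving `(p b / (p + b))^(k/2)` up to a constant, with
`p ≤ a` and `p + b = ν + n`.

No derivative of `κ` is taken: the bounds on `D` come from the identity `exp D - 1 = E[exp Y - 1 -
Y]` for the centered variable `Y = ⟪θ - θ₀, s - E s⟫` under `P_θ₀`. -/

namespace ExpFamily

variable {d k : ℕ} {F : ExpFamily d k}

/-! ### Exponential moments of the sufficient statistics -/

/-- The log-partition function `κ`, as a real-valued function. -/
noncomputable def logPartition (F : ExpFamily d k) (θ : EuclideanSpace ℝ (Fin k)) : ℝ :=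
  (F.kappa θ).toReal

/-- The mean of the sufficient statistics under `P_θ`. -/
noncomputable def mean (F : ExpFamily d k) (θ : EuclideanSpace ℝ (Fin k)) :
    EuclideanSpace ℝ (Fin k) :=
  ∫ x, F.s x ∂(F.P θ)

/-- The Bregman divergence of the log-partition function, based at `θ₀`. -/
noncomputable def bregman (F : ExpFamily d k) (θ₀ θ : EuclideanSpace ℝ (Fin k)) : ℝ :=
  F.logPartition θ - F.logPartition θ₀ - ⟪F.mean θ₀, θ - θ₀⟫

theorem measurable_exp_inner (F : ExpFamily d k) (θ : EuclideanSpace ℝ (Fin k)) :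
    Measurable fun x => Real.exp ⟪θ, F.s x⟫ := by
  have := F.measurable_s
  fun_prop

theorem measurable_density (F : ExpFamily d k) (θ : EuclideanSpace ℝ (Fin k)) :
    Measurable (F.density θ) := by
  have := F.measurable_s
  unfold density
  fun_prop

theorem IsRegular.mem_iff (hF : F.IsRegular) {θ : EuclideanSpace ℝ (Fin k)} :
    θ ∈ F.Θ ↔ Integrable (fun x => Real.exp ⟪θ, F.s x⟫) F.lam := by
  rw [hF.full, Set.mem_ofPred_eq, kappa, ENNReal.log_lt_top_iff, Integrable,
    hasFiniteIntegral_iff_ofReal (.of_forall fun _ => (Real.exp_pos _).le)]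
  exact ⟨fun h => ⟨(F.measurable_exp_inner θ).aestronglyMeasurable, h⟩, fun h => h.2⟩

theorem IsRegular.exp_logPartition (hF : F.IsRegular) {θ : EuclideanSpace ℝ (Fin k)}
    (hθ : θ ∈ F.Θ) : Real.exp (F.logPartition θ) = ∫ x, Real.exp ⟪θ, F.s x⟫ ∂F.lam := by
  have hint := hF.mem_iff.1 hθ
  have : NeZero F.lam := ⟨fun h => F.lam_univ_ne_zero (by simp [h])⟩
  have hpos := integral_exp_pos hint
  rw [logPartition, kappa, ← ofReal_integral_eq_lintegral_ofReal hint
    (.of_forall fun _ => (Real.exp_pos _).le), ENNReal.log_ofReal_of_pos hpos, EReal.toReal_coe,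
    Real.exp_log hpos]

theorem density_eq (F : ExpFamily d k) (θ : EuclideanSpace ℝ (Fin k)) (x : F.carrier) :
    F.density θ x = Real.exp (-F.logPartition θ) * Real.exp ⟪θ, F.s x⟫ := by
  rw [density, ← Real.exp_add, logPartition]
  ring_nf

theorem integrable_P_iff {E : Type*} [NormedAddCommGroup E] [NormedSpace ℝ E]
    {θ : EuclideanSpace ℝ (Fin k)} {f : F.carrier → E} :
    Integrable f (F.P θ) ↔ Integrable (fun x => Real.exp ⟪θ, F.s x⟫ • f x) F.lam := by
  rw [P, integrable_withDensity_iff_integrable_smul' (F.measurable_density θ).ennreal_ofReal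
    (.of_forall fun _ => ENNReal.ofReal_lt_top)]
  have (x : F.carrier) : (ENNReal.ofReal (F.density θ x)).toReal • f x =
      Real.exp (-F.logPartition θ) • Real.exp ⟪θ, F.s x⟫ • f x := by
    rw [density_eq, ENNReal.toReal_ofReal (by positivity), smul_smul]
  simp_rw [this]
  exact integrable_fun_smul_iff (Real.exp_pos _).ne' _

theorem integral_P {E : Type*} [NormedAddCommGroup E] [NormedSpace ℝ E]
    (θ : EuclideanSpace ℝ (Fin k)) (f : F.carrier → E) :
    ∫ x, f x ∂(F.P θ) =
      Real.exp (-F.logPartition θ) • ∫ x, Real.exp ⟪θ, F.s x⟫ • f x ∂F.lam := by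
  rw [P, integral_withDensity_eq_integral_toReal_smul (F.measurable_density θ).ennreal_ofReal
    (.of_forall fun _ => ENNReal.ofReal_lt_top), ← integral_smul]
  congr with x
  rw [density_eq, ENNReal.toReal_ofReal (by positivity), smul_smul]

theorem IsRegular.isProbabilityMeasure (hF : F.IsRegular) {θ : EuclideanSpace ℝ (Fin k)}
    (hθ : θ ∈ F.Θ) : IsProbabilityMeasure (F.P θ) := by
  have hint := hF.mem_iff.1 hθ
  refine ⟨?_⟩
  rw [P, withDensity_apply _ MeasurableSet.univ, Measure.restrict_univ]
  simp_rw [density_eq]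
  rw [← ofReal_integral_eq_lintegral_ofReal (hint.const_mul _)
    (.of_forall fun _ => by positivity), integral_const_mul, ← hF.exp_logPartition hθ,
    ← Real.exp_add]
  simp

theorem IsRegular.integrable_exp (hF : F.IsRegular) {θ h : EuclideanSpace ℝ (Fin k)}
    (hh : θ + h ∈ F.Θ) : Integrable (fun x => Real.exp ⟪h, F.s x⟫) (F.P θ) := by
  rw [integrable_P_iff]
  simpa [inner_add_left, Real.exp_add] using hF.mem_iff.1 hh

theorem IsRegular.integral_exp (hF : F.IsRegular) {θ h : EuclideanSpace ℝ (Fin k)}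
    (hh : θ + h ∈ F.Θ) :
    ∫ x, Real.exp ⟪h, F.s x⟫ ∂(F.P θ) =
      Real.exp (F.logPartition (θ + h) - F.logPartition θ) := by
  rw [integral_P, sub_eq_neg_add, Real.exp_add, hF.exp_logPartition hh]
  simp [inner_add_left, Real.exp_add]

theorem IsRegular.convex (hF : F.IsRegular) : Convex ℝ F.Θ := by
  intro θ hθ θ' hθ' a b ha hb hab
  rw [hF.mem_iff] at *
  refine ((hθ.const_mul a).add (hθ'.const_mul b)).mono'
    (F.measurable_exp_inner _).aestronglyMeasurable (.of_forall fun x => ?_)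
  rw [Real.norm_eq_abs, Real.abs_exp, inner_add_left, inner_smul_left, inner_smul_left]
  exact convexOn_exp.2 (Set.mem_univ _) (Set.mem_univ _) ha hb hab

/-- The largest coordinate of `y` controls the norm, and its sign selects one of the two
exponentials. The divisor `k + 1` instead of `k` keeps the rate meaningful when `k = 0`. -/
theorem exp_norm_le_sum (ρ : ℝ) (hρ : 0 ≤ ρ) (y : EuclideanSpace ℝ (Fin k)) :
    Real.exp (ρ / (k + 1) * ‖y‖) ≤ 1 + ∑ i, (Real.exp ⟪ρ • EuclideanSpace.single i (1 : ℝ), y⟫ +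
      Real.exp ⟪-(ρ • EuclideanSpace.single i (1 : ℝ)), y⟫) := by
  have hnorm : ‖y‖ ≤ ∑ i, |y i| := by
    rw [EuclideanSpace.norm_eq]
    refine Real.sqrt_le_iff.2 ⟨by positivity, ?_⟩
    simpa using Finset.sum_sq_le_sq_sum_of_nonneg (s := Finset.univ) (f := fun i => |y i|)
      (fun i _ => abs_nonneg _)
  have hin (i : Fin k) : ⟪ρ • EuclideanSpace.single i (1 : ℝ), y⟫ = ρ * y i := by
    simp [inner_smul_left, EuclideanSpace.inner_single_left]
  have hterm (i : Fin k) : 0 ≤ Real.exp ⟪ρ • EuclideanSpace.single i (1 : ℝ), y⟫ +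
      Real.exp ⟪-(ρ • EuclideanSpace.single i (1 : ℝ)), y⟫ := by positivity
  rcases Nat.eq_zero_or_pos k with hk | hk
  · subst hk
    simp [Subsingleton.elim y 0]
  obtain ⟨i, -, hi⟩ := Finset.exists_max_image Finset.univ (fun i => |y i|)
    ⟨⟨0, hk⟩, Finset.mem_univ _⟩
  have h1 : ‖y‖ ≤ (k + 1) * |y i| := by
    have := Finset.sum_le_card_nsmul Finset.univ (fun i => |y i|) _ hi
    simp only [Finset.card_univ, Fintype.card_fin, nsmul_eq_mul] at this
    nlinarith [abs_nonneg (y i)]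
  have h2 : ρ / (k + 1) * ‖y‖ ≤ ρ * |y i| := by
    rw [div_mul_eq_mul_div, div_le_iff₀ (by positivity)]
    nlinarith
  have h3 : Real.exp (ρ * |y i|) ≤ Real.exp ⟪ρ • EuclideanSpace.single i (1 : ℝ), y⟫ +
      Real.exp ⟪-(ρ • EuclideanSpace.single i (1 : ℝ)), y⟫ := by
    rw [inner_neg_left, hin]
    rcases abs_cases (y i) with ⟨h, -⟩ | ⟨h, -⟩ <;> rw [h]
    · linarith [Real.exp_pos (-(ρ * y i))]
    · rw [mul_neg]
      linarith [Real.exp_pos (ρ * y i)]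
  calc _ ≤ _ := Real.exp_le_exp.2 h2
    _ ≤ _ := h3
    _ ≤ _ := Finset.single_le_sum (fun i _ => hterm i) (Finset.mem_univ i)
    _ ≤ _ := by linarith

theorem IsRegular.integrable_exp_add_exp_neg (hF : F.IsRegular)
    {θ : EuclideanSpace ℝ (Fin k)} {ρ : ℝ} (hρ : 0 ≤ ρ) (hsub : Metric.closedBall θ ρ ⊆ F.Θ)
    (i : Fin k) :
    Integrable (fun x => Real.exp ⟪ρ • EuclideanSpace.single i (1 : ℝ), F.s x⟫ +
      Real.exp ⟪-(ρ • EuclideanSpace.single i (1 : ℝ)), F.s x⟫) (F.P θ) :=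
  (hF.integrable_exp (hsub (by simp [norm_smul, abs_of_nonneg hρ]))).add
    (hF.integrable_exp (hsub (by simp [norm_smul, abs_of_nonneg hρ])))

theorem IsRegular.integrable_exp_norm (hF : F.IsRegular) {θ : EuclideanSpace ℝ (Fin k)} {ρ : ℝ}
    (hρ : 0 ≤ ρ) (hsub : Metric.closedBall θ ρ ⊆ F.Θ) :
    Integrable (fun x => Real.exp (ρ / (k + 1) * ‖F.s x‖)) (F.P θ) := by
  have hm := F.measurable_s
  have hp := hF.isProbabilityMeasure (hsub (Metric.mem_closedBall_self hρ))
  refine ((integrable_const 1).add <| integrable_finsetSum Finset.univ fun i _ =>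
    hF.integrable_exp_add_exp_neg hρ hsub i).mono' (by fun_prop) (.of_forall fun x => ?_)
  rw [Real.norm_eq_abs, Real.abs_exp]
  exact exp_norm_le_sum ρ hρ (F.s x)

/-- The bound depends on `θ` only through a bound for `κ` near `θ`, hence is uniform over compact
sets of parameters. -/
theorem IsRegular.integral_exp_norm_le (hF : F.IsRegular) {θ : EuclideanSpace ℝ (Fin k)} {ρ : ℝ}
    (hρ : 0 ≤ ρ) {M : ℝ} (hsub : Metric.closedBall θ ρ ⊆ F.Θ)
    (hM : ∀ θ' ∈ Metric.closedBall θ ρ, |F.logPartition θ'| ≤ M) :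
    ∫ x, Real.exp (ρ / (k + 1) * ‖F.s x‖) ∂(F.P θ) ≤ 1 + 2 * k * Real.exp (2 * M) := by
  have hp := hF.isProbabilityMeasure (hsub (Metric.mem_closedBall_self hρ))
  have h0 := abs_le.1 (hM θ (Metric.mem_closedBall_self hρ))
  have hb (v : EuclideanSpace ℝ (Fin k)) (hv : ‖v‖ ≤ ρ) :
      Integrable (fun x => Real.exp ⟪v, F.s x⟫) (F.P θ) ∧
      ∫ x, Real.exp ⟪v, F.s x⟫ ∂(F.P θ) ≤ Real.exp (2 * M) := by
    have hmem : θ + v ∈ Metric.closedBall θ ρ := by simpa using hv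
    rw [hF.integral_exp (hsub hmem)]
    have := abs_le.1 (hM _ hmem)
    exact ⟨hF.integrable_exp (hsub hmem), Real.exp_le_exp.2 (by linarith)⟩
  have hadd := hF.integrable_exp_add_exp_neg hρ hsub
  have hsum := integrable_finsetSum Finset.univ fun i _ => hadd i
  refine (integral_mono (hF.integrable_exp_norm hρ hsub) ((integrable_const 1).add hsum)
    fun x => exp_norm_le_sum ρ hρ (F.s x)).trans ?_
  simp only [Pi.add_apply]
  rw [integral_add (integrable_const 1) hsum, integral_finsetSum _ fun i _ => hadd i]
  have : ∑ i : Fin k, ∫ x, (Real.exp ⟪ρ • EuclideanSpace.single i (1 : ℝ), F.s x⟫ +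
      Real.exp ⟪-(ρ • EuclideanSpace.single i (1 : ℝ)), F.s x⟫) ∂(F.P θ) ≤
      ∑ i : Fin k, (Real.exp (2 * M) + Real.exp (2 * M)) := by
    refine Finset.sum_le_sum fun i _ => ?_
    have h1 := hb (ρ • EuclideanSpace.single i (1 : ℝ)) (by simp [norm_smul, abs_of_nonneg hρ])
    have h2 := hb (-(ρ • EuclideanSpace.single i (1 : ℝ)))
      (by simp [norm_smul, abs_of_nonneg hρ])
    rw [integral_add h1.1 h2.1]
    exact add_le_add h1.2 h2.2
  simp only [Finset.sum_const, Finset.card_univ, Fintype.card_fin, nsmul_eq_mul] at this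
  simp only [integral_const, probReal_univ, smul_eq_mul, mul_one]
  linarith

end ExpFamily

/-! ### Two-sided bounds on the Bregman divergence -/

theorem Real.exp_sub_one_sub_id_le_sq_mul_exp_abs (y : ℝ) :
    Real.exp y - 1 - y ≤ y ^ 2 * Real.exp |y| := by
  rcases le_total |y| 1 with h | h
  · have := (abs_le.1 (Real.abs_exp_sub_one_sub_id_le h)).2
    nlinarith [Real.one_le_exp (abs_nonneg y), sq_nonneg y]
  · rcases abs_cases y with ⟨h1, h2⟩ | ⟨h1, h2⟩
    · rw [h1] at h ⊢
      have : 1 ≤ y ^ 2 := one_le_pow₀ h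
      nlinarith [Real.exp_pos y]
    · rw [h1] at h ⊢
      nlinarith [Real.exp_le_one_iff.2 h2.le, Real.one_le_exp (x := -y) (by linarith)]

/-- The truncation at 1 is needed because the right side grows only linearly at `-∞`; it also makes
the resulting moment bounded and easy to pass to limits. -/
theorem Real.min_sq_one_div_four_le_exp_sub (y : ℝ) :
    min (y ^ 2) 1 / 4 ≤ Real.exp y - 1 - y := by
  rcases le_total 0 y with h | h
  · have := Real.quadratic_le_exp_of_nonneg h
    nlinarith [min_le_left (y ^ 2) 1, sq_nonneg y]
  rcases le_total (-1) y with h1 | h1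
  · have habs : |y| ≤ 1 := abs_le.2 ⟨h1, h.trans zero_le_one⟩
    have := (abs_le.1 (Real.exp_bound habs (n := 3) (by norm_num))).1
    simp only [Finset.sum_range_succ, Finset.sum_range_zero, Nat.factorial] at this
    norm_num at this
    have h3 : |y| ^ 3 ≤ y ^ 2 := by
      rw [pow_succ, sq_abs]
      nlinarith [sq_nonneg y]
    nlinarith [min_le_left (y ^ 2) 1, sq_nonneg y]
  · have h2 : Real.exp y = Real.exp (-1) * Real.exp (y + 1) := by
      rw [← Real.exp_add]; ring_nf
    have h3 := Real.add_one_le_exp (y + 1)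
    have h4 := Real.exp_neg_one_gt_d9
    have h5 : Real.exp (-1) ≤ 1 := Real.exp_le_one_iff.2 (by norm_num)
    have h6 := mul_le_mul_of_nonneg_left h3 (Real.exp_pos (-1)).le
    nlinarith [min_le_right (y ^ 2) 1]

namespace ExpFamily

variable {d k : ℕ} {F : ExpFamily d k}

theorem IsRegular.integrable_s (hF : F.IsRegular) {θ : EuclideanSpace ℝ (Fin k)}
    (hθ : θ ∈ F.Θ) : Integrable F.s (F.P θ) := by
  obtain ⟨ρ, hρ, hsub⟩ := Metric.nhds_basis_closedBall.mem_iff.1 (hF.isOpen.mem_nhds hθ)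
  have hτ : 0 < ρ / (k + 1) := by positivity
  refine ((hF.integrable_exp_norm hρ.le hsub).const_mul (ρ / (k + 1))⁻¹).mono'
    F.measurable_s.aestronglyMeasurable (.of_forall fun x => ?_)
  rw [inv_mul_eq_div, le_div_iff₀ hτ, mul_comm]
  linarith [Real.add_one_le_exp (ρ / (k + 1) * ‖F.s x‖)]

theorem IsRegular.integral_inner_sub_mean (hF : F.IsRegular) {θ : EuclideanSpace ℝ (Fin k)}
    (hθ : θ ∈ F.Θ) (h : EuclideanSpace ℝ (Fin k)) :
    Integrable (fun x => ⟪h, F.s x - F.mean θ⟫) (F.P θ) ∧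
      ∫ x, ⟪h, F.s x - F.mean θ⟫ ∂(F.P θ) = 0 := by
  have := hF.isProbabilityMeasure hθ
  have hs := hF.integrable_s hθ
  have hi : Integrable (fun x => F.s x - F.mean θ) (F.P θ) := hs.sub (integrable_const _)
  refine ⟨hi.const_inner h, ?_⟩
  rw [integral_inner hi h, integral_sub hs (integrable_const _)]
  simp [mean]

theorem IsRegular.exp_bregman (hF : F.IsRegular) {θ₀ θ : EuclideanSpace ℝ (Fin k)}
    (hθ : θ ∈ F.Θ) :
    Integrable (fun x => Real.exp ⟪θ - θ₀, F.s x - F.mean θ₀⟫) (F.P θ₀) ∧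
      ∫ x, Real.exp ⟪θ - θ₀, F.s x - F.mean θ₀⟫ ∂(F.P θ₀) = Real.exp (F.bregman θ₀ θ) := by
  have hh : θ₀ + (θ - θ₀) ∈ F.Θ := by simpa using hθ
  have heq (x : F.carrier) : Real.exp ⟪θ - θ₀, F.s x - F.mean θ₀⟫ =
      Real.exp (-⟪F.mean θ₀, θ - θ₀⟫) * Real.exp ⟪θ - θ₀, F.s x⟫ := by
    rw [← Real.exp_add, inner_sub_right, real_inner_comm (θ - θ₀)]
    ring_nf
  simp_rw [heq]
  refine ⟨(hF.integrable_exp hh).const_mul _, ?_⟩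
  rw [integral_const_mul, hF.integral_exp hh, ← Real.exp_add, bregman, add_sub_cancel]
  ring_nf

/-- The Bregman divergence is the cumulant generating function of the centered statistic, whose
linear term integrates to zero. -/
theorem IsRegular.exp_bregman_sub_one (hF : F.IsRegular) {θ₀ θ : EuclideanSpace ℝ (Fin k)}
    (hθ₀ : θ₀ ∈ F.Θ) (hθ : θ ∈ F.Θ) :
    Integrable (fun x => Real.exp ⟪θ - θ₀, F.s x - F.mean θ₀⟫ - 1 -
        ⟪θ - θ₀, F.s x - F.mean θ₀⟫) (F.P θ₀) ∧
      Real.exp (F.bregman θ₀ θ) - 1 = ∫ x, (Real.exp ⟪θ - θ₀, F.s x - F.mean θ₀⟫ - 1 -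
        ⟪θ - θ₀, F.s x - F.mean θ₀⟫) ∂(F.P θ₀) := by
  have := hF.isProbabilityMeasure hθ₀
  obtain ⟨hi, he⟩ := hF.exp_bregman (θ₀ := θ₀) hθ
  obtain ⟨hl, hl0⟩ := hF.integral_inner_sub_mean hθ₀ (θ - θ₀)
  have hi1 : Integrable (fun x => Real.exp ⟪θ - θ₀, F.s x - F.mean θ₀⟫ - 1) (F.P θ₀) :=
    hi.sub (integrable_const _)
  refine ⟨hi1.sub hl, ?_⟩
  rw [integral_sub hi1 hl, integral_sub hi (integrable_const _), he, hl0]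
  simp

/-- A truncated second moment of `s - μ` in direction `v` under `P_θ`. -/
noncomputable def spread (F : ExpFamily d k) (θ μ v : EuclideanSpace ℝ (Fin k)) : ℝ :=
  ∫ x, min (⟪v, F.s x - μ⟫ ^ 2) 1 ∂(F.P θ)

theorem IsRegular.integrable_min (hF : F.IsRegular) {θ : EuclideanSpace ℝ (Fin k)}
    (hθ : θ ∈ F.Θ) (μ v : EuclideanSpace ℝ (Fin k)) :
    Integrable (fun x => min (⟪v, F.s x - μ⟫ ^ 2) 1) (F.P θ) := by
  have := hF.isProbabilityMeasure hθ
  have hm := F.measurable_s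
  refine (integrable_const (1 : ℝ)).mono' (Measurable.aestronglyMeasurable (by fun_prop))
    (.of_forall fun x => ?_)
  rw [Real.norm_of_nonneg (by positivity)]
  exact min_le_right _ _

theorem spread_nonneg (F : ExpFamily d k) (θ μ v : EuclideanSpace ℝ (Fin k)) :
    0 ≤ F.spread θ μ v :=
  integral_nonneg fun _ => by positivity

theorem IsRegular.spread_le_one (hF : F.IsRegular) {θ : EuclideanSpace ℝ (Fin k)}
    (hθ : θ ∈ F.Θ) (μ v : EuclideanSpace ℝ (Fin k)) : F.spread θ μ v ≤ 1 := by
  have := hF.isProbabilityMeasure hθ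
  refine (integral_mono (hF.integrable_min hθ μ v) (integrable_const (1 : ℝ))
    fun x => min_le_right _ _).trans ?_
  simp

theorem IsRegular.spread_le_bregman (hF : F.IsRegular) {θ₀ θ : EuclideanSpace ℝ (Fin k)}
    (hθ₀ : θ₀ ∈ F.Θ) (hθ : θ ∈ F.Θ) :
    F.spread θ₀ (F.mean θ₀) (θ - θ₀) / 8 ≤ F.bregman θ₀ θ := by
  obtain ⟨hi, he⟩ := hF.exp_bregman_sub_one hθ₀ hθ
  have h1 : F.spread θ₀ (F.mean θ₀) (θ - θ₀) / 4 ≤ Real.exp (F.bregman θ₀ θ) - 1 := by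
    rw [he, spread, ← integral_div]
    exact integral_mono ((hF.integrable_min hθ₀ _ _).div_const _) hi
      fun x => Real.min_sq_one_div_four_le_exp_sub _
  have h3 := F.spread_nonneg θ₀ (F.mean θ₀) (θ - θ₀)
  have h4 := hF.spread_le_one hθ₀ (F.mean θ₀) (θ - θ₀)
  set u := F.spread θ₀ (F.mean θ₀) (θ - θ₀)
  set D := F.bregman θ₀ θ
  have h5 := Real.add_one_le_exp (-D)
  -- Since `u ≤ 1`, `(1 + u/4)(1 - u/8) ≥ 1`; combined with `1 - exp(-D) ≤ D` this turns the bound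
  -- on `exp D - 1` into one on `D`.
  have h6 : Real.exp (-D) ≤ 1 - u / 8 := by
    rw [Real.exp_neg, inv_le_comm₀ (Real.exp_pos _) (by linarith)]
    refine (inv_le_of_inv_le₀ (by linarith) ?_).trans (by linarith : 1 + u / 4 ≤ _)
    rw [inv_le_iff_one_le_mul₀ (by linarith)]
    nlinarith
  linarith

theorem IsRegular.bregman_nonneg (hF : F.IsRegular) {θ₀ θ : EuclideanSpace ℝ (Fin k)}
    (hθ₀ : θ₀ ∈ F.Θ) (hθ : θ ∈ F.Θ) : 0 ≤ F.bregman θ₀ θ :=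
  (div_nonneg (F.spread_nonneg _ _ _) (by norm_num)).trans (hF.spread_le_bregman hθ₀ hθ)

theorem IsRegular.convexOn_logPartition (hF : F.IsRegular) : ConvexOn ℝ F.Θ F.logPartition := by
  refine ⟨hF.convex, fun θ hθ θ' hθ' a b ha hb hab => ?_⟩
  have h0 := hF.convex hθ hθ' ha hb hab
  have h1 := mul_nonneg ha (hF.bregman_nonneg h0 hθ)
  have h2 := mul_nonneg hb (hF.bregman_nonneg h0 hθ')
  have h3 : a * ⟪F.mean (a • θ + b • θ'), θ - (a • θ + b • θ')⟫ +
      b * ⟪F.mean (a • θ + b • θ'), θ' - (a • θ + b • θ')⟫ = 0 := by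
    rw [← real_inner_smul_right, ← real_inner_smul_right, ← inner_add_right]
    have : a • (θ - (a • θ + b • θ')) + b • (θ' - (a • θ + b • θ')) =
        (1 - (a + b)) • (a • θ + b • θ') := by module
    rw [this, hab]
    simp
  simp only [bregman, smul_eq_mul] at h1 h2 ⊢
  have h4 : (a + b) * F.logPartition (a • θ + b • θ') = F.logPartition (a • θ + b • θ') := by
    rw [hab, one_mul]
  linarith

theorem IsRegular.continuousOn_logPartition (hF : F.IsRegular) :
    ContinuousOn F.logPartition F.Θ :=
  hF.convexOn_logPartition.continuousOn hF.isOpen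

theorem IsRegular.norm_mean_le (hF : F.IsRegular) {θ : EuclideanSpace ℝ (Fin k)}
    (hθ : θ ∈ F.Θ) {τ : ℝ} (hτ : 0 < τ)
    (hint : Integrable (fun x => Real.exp (τ * ‖F.s x‖)) (F.P θ)) :
    ‖F.mean θ‖ ≤ τ⁻¹ * ∫ x, Real.exp (τ * ‖F.s x‖) ∂(F.P θ) := by
  refine (norm_integral_le_integral_norm _).trans ?_
  rw [← integral_const_mul]
  refine integral_mono (hF.integrable_s hθ).norm (hint.const_mul _) fun x => ?_
  simp only
  rw [inv_mul_eq_div, le_div_iff₀ hτ, mul_comm]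
  linarith [Real.add_one_le_exp (τ * ‖F.s x‖)]

theorem IsRegular.bregman_le_of_exp_moment (hF : F.IsRegular)
    {θ₀ θ : EuclideanSpace ℝ (Fin k)} (hθ₀ : θ₀ ∈ F.Θ) (hθ : θ ∈ F.Θ) {τ : ℝ} (hτ : 0 < τ)
    (hint : Integrable (fun x => Real.exp (τ * ‖F.s x‖)) (F.P θ₀)) (hle : ‖θ - θ₀‖ ≤ τ / 2) :
    F.bregman θ₀ θ ≤ 8 / τ ^ 2 * Real.exp (τ * ‖F.mean θ₀‖) *
      (∫ x, Real.exp (τ * ‖F.s x‖) ∂(F.P θ₀)) * ‖θ - θ₀‖ ^ 2 := by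
  obtain ⟨hi, he⟩ := hF.exp_bregman_sub_one hθ₀ hθ
  have h3 : F.bregman θ₀ θ ≤ Real.exp (F.bregman θ₀ θ) - 1 := by
    linarith [Real.add_one_le_exp (F.bregman θ₀ θ)]
  rw [mul_right_comm, ← integral_const_mul]
  refine (h3.trans he.le).trans (integral_mono hi (hint.const_mul _) fun x => ?_)
  refine (Real.exp_sub_one_sub_id_le_sq_mul_exp_abs _).trans ?_
  set h := θ - θ₀
  set z := F.s x - F.mean θ₀ with hz
  have hzn : ‖z‖ ≤ ‖F.s x‖ + ‖F.mean θ₀‖ := norm_sub_le _ _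
  have h4 : |⟪h, z⟫| ≤ ‖h‖ * ‖z‖ := abs_real_inner_le_norm _ _
  have h5 : ⟪h, z⟫ ^ 2 ≤ ‖h‖ ^ 2 * ‖z‖ ^ 2 := by
    rw [← sq_abs, ← mul_pow]
    gcongr
  have h6 : |⟪h, z⟫| ≤ τ / 2 * ‖z‖ := h4.trans (by gcongr)
  have h7 : ‖z‖ ^ 2 ≤ 8 / τ ^ 2 * Real.exp (τ / 2 * ‖z‖) := by
    have := Real.quadratic_le_exp_of_nonneg (x := τ / 2 * ‖z‖) (by positivity)
    rw [div_mul_eq_mul_div, le_div_iff₀ (by positivity)]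
    have : 0 ≤ τ * ‖z‖ := by positivity
    nlinarith
  calc ⟪h, z⟫ ^ 2 * Real.exp |⟪h, z⟫|
      ≤ ‖h‖ ^ 2 * (8 / τ ^ 2 * Real.exp (τ / 2 * ‖z‖)) * Real.exp (τ / 2 * ‖z‖) := by
        gcongr
        exact h5.trans (by gcongr)
    _ = 8 / τ ^ 2 * ‖h‖ ^ 2 * Real.exp (τ * ‖z‖) := by
        rw [show τ * ‖z‖ = τ / 2 * ‖z‖ + τ / 2 * ‖z‖ by ring, Real.exp_add]
        ring
    _ ≤ 8 / τ ^ 2 * ‖h‖ ^ 2 * Real.exp (τ * ‖F.mean θ₀‖ + τ * ‖F.s x‖) := by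
        gcongr
        nlinarith
    _ = _ := by
        rw [Real.exp_add]
        ring

/-- On a compact set of base points, the Bregman divergence is at most quadratic. -/
theorem IsRegular.exists_bregman_le (hF : F.IsRegular) {K : Set (EuclideanSpace ℝ (Fin k))}
    (hK : IsCompact K) (hKΘ : K ⊆ F.Θ) :
    ∃ r > 0, Metric.cthickening r K ⊆ F.Θ ∧ ∃ C > 0, ∀ θ₀ ∈ K, ∀ θ, ‖θ - θ₀‖ ≤ r →
      F.bregman θ₀ θ ≤ C * ‖θ - θ₀‖ ^ 2 := by
  obtain ⟨ρ, hρ, hsub⟩ := hK.exists_cthickening_subset_open hF.isOpen hKΘ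
  obtain ⟨M, hM⟩ := (hK.cthickening (r := ρ)).exists_bound_of_continuousOn
    (hF.continuousOn_logPartition.mono hsub)
  set τ := ρ / (k + 1) with hτdef
  have hτ : 0 < τ := by positivity
  set B := 1 + 2 * k * Real.exp (2 * M) with hB
  have hBpos : 0 < B := by positivity
  have hr : min ρ (τ / 2) ≤ ρ := min_le_left _ _
  refine ⟨min ρ (τ / 2), by positivity, (Metric.cthickening_mono hr K).trans hsub,
    8 / τ ^ 2 * Real.exp (τ * (τ⁻¹ * B)) * B, by positivity, fun θ₀ hθ₀ θ hθ => ?_⟩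
  have hball : Metric.closedBall θ₀ ρ ⊆ Metric.cthickening ρ K :=
    Metric.closedBall_subset_cthickening hθ₀ ρ
  have hint := hF.integrable_exp_norm hρ.le (hball.trans hsub)
  have hbd := hF.integral_exp_norm_le hρ.le (hball.trans hsub) fun θ' hθ' => hM θ' (hball hθ')
  have hmean := hF.norm_mean_le (hKΘ hθ₀) hτ hint
  have hmem : θ ∈ F.Θ := hsub (hball (by rw [mem_closedBall_iff_norm]; exact hθ.trans hr))
  refine (hF.bregman_le_of_exp_moment (hKΘ hθ₀) hmem hτ hint
    (hθ.trans (min_le_right _ _))).trans ?_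
  have h0 : 0 ≤ ∫ x, Real.exp (τ * ‖F.s x‖) ∂(F.P θ₀) :=
    integral_nonneg fun _ => Real.exp_nonneg _
  gcongr
  exact hmean.trans (by gcongr)

/-- Dominated convergence: the truncated factor is at most 1, and the change of tilt is absorbed by
an exponential moment at `θ₀`. -/
theorem IsRegular.continuousAt_spread (hF : F.IsRegular) {θ₀ : EuclideanSpace ℝ (Fin k)}
    (hθ₀ : θ₀ ∈ F.Θ) (μ₀ v₀ : EuclideanSpace ℝ (Fin k)) :
    ContinuousAt (fun p : EuclideanSpace ℝ (Fin k) × EuclideanSpace ℝ (Fin k) ×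
      EuclideanSpace ℝ (Fin k) => F.spread p.1 p.2.1 p.2.2) (θ₀, μ₀, v₀) := by
  have hm := F.measurable_s
  obtain ⟨ρ, hρ, hsub⟩ := Metric.nhds_basis_closedBall.mem_iff.1 (hF.isOpen.mem_nhds hθ₀)
  have hτ : 0 < ρ / (k + 1) := by positivity
  have hbound := integrable_P_iff.1 (hF.integrable_exp_norm hρ.le hsub)
  simp only [spread, integral_P, smul_eq_mul]
  refine ContinuousAt.mul ?_ (continuousAt_of_dominated (bound := fun x =>
    Real.exp ⟪θ₀, F.s x⟫ • Real.exp (ρ / (k + 1) * ‖F.s x‖)) ?_ ?_ hbound ?_)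
  · exact Real.continuous_exp.continuousAt.comp (ContinuousAt.neg <|
      ContinuousAt.comp (f := Prod.fst) (g := F.logPartition)
        (hF.continuousOn_logPartition.continuousAt (hF.isOpen.mem_nhds hθ₀)) continuousAt_fst)
  · exact .of_forall fun p => Measurable.aestronglyMeasurable (by fun_prop)
  · have hnear : ∀ᶠ p : EuclideanSpace ℝ (Fin k) × EuclideanSpace ℝ (Fin k) ×
        EuclideanSpace ℝ (Fin k) in nhds (θ₀, μ₀, v₀), p.1 ∈ Metric.ball θ₀ (ρ / (k + 1)) :=
      continuousAt_fst.eventually (Metric.ball_mem_nhds θ₀ hτ)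
    filter_upwards [hnear] with p hp
    refine .of_forall fun x => ?_
    rw [Real.norm_of_nonneg (by positivity), smul_eq_mul, ← Real.exp_add]
    refine (mul_le_of_le_one_right (Real.exp_nonneg _) (min_le_right _ _)).trans
      (Real.exp_le_exp.2 ?_)
    have h1 : ⟪p.1 - θ₀, F.s x⟫ ≤ ‖p.1 - θ₀‖ * ‖F.s x‖ := real_inner_le_norm _ _
    rw [inner_sub_left] at h1
    have h2 : ‖p.1 - θ₀‖ * ‖F.s x‖ ≤ ρ / (k + 1) * ‖F.s x‖ := by
      gcongr
      exact (mem_ball_iff_norm.1 hp).le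
    linarith
  · refine .of_forall fun x => Continuous.continuousAt ?_
    fun_prop

/-- Otherwise `⟪v, s⟫` is almost everywhere constant, so moving `θ` along `v` leaves `P_θ`
unchanged, against identifiability. -/
theorem IsRegular.spread_pos (hF : F.IsRegular) {θ : EuclideanSpace ℝ (Fin k)}
    (hθ : θ ∈ F.Θ) (μ : EuclideanSpace ℝ (Fin k)) {v : EuclideanSpace ℝ (Fin k)} (hv : v ≠ 0) :
    0 < F.spread θ μ v := by
  refine (F.spread_nonneg θ μ v).lt_of_ne fun h0 => ?_
  have hzero : ∀ᵐ x ∂F.lam, ⟪v, F.s x⟫ = ⟪v, μ⟫ := by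
    have h1 := integrable_P_iff.1 (hF.integrable_min hθ μ v)
    have h2 : ∫ x, Real.exp ⟪θ, F.s x⟫ • min (⟪v, F.s x - μ⟫ ^ 2) 1 ∂F.lam = 0 := by
      rw [spread, integral_P] at h0
      exact (smul_eq_zero.1 h0.symm).resolve_left (Real.exp_ne_zero _)
    rw [integral_eq_zero_iff_of_nonneg (fun x => smul_nonneg (Real.exp_nonneg _)
      (by positivity)) h1] at h2
    filter_upwards [h2] with x hx
    have h3 : min (⟪v, F.s x - μ⟫ ^ 2) 1 = 0 :=
      (smul_eq_zero.1 hx).resolve_left (Real.exp_ne_zero _)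
    have h4 : ⟪v, F.s x - μ⟫ ^ 2 = 0 := by
      rcases min_choice (⟪v, F.s x - μ⟫ ^ 2) 1 with h | h <;> rw [h] at h3
      · exact h3
      · exact absurd h3 one_ne_zero
    rw [sq_eq_zero_iff, inner_sub_right] at h4
    linarith
  obtain ⟨ρ, hρ, hsub⟩ := Metric.nhds_basis_closedBall.mem_iff.1 (hF.isOpen.mem_nhds hθ)
  have hvn : 0 < ‖v‖ := norm_pos_iff.2 hv
  set t := ρ / ‖v‖ with ht
  have htpos : 0 < t := by positivity
  have hmem : θ + t • v ∈ F.Θ := hsub (by simp [norm_smul, ht, hvn.ne', abs_of_pos hρ])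
  refine hF.identifiable _ hmem θ hθ (by simp [htpos.ne', hv]) ?_
  have hexp : ∀ᵐ x ∂F.lam, Real.exp ⟪θ + t • v, F.s x⟫ =
      Real.exp (t * ⟪v, μ⟫) * Real.exp ⟪θ, F.s x⟫ := by
    filter_upwards [hzero] with x hx
    rw [inner_add_left, real_inner_smul_left, hx, Real.exp_add, mul_comm]
  have hk : F.logPartition (θ + t • v) = t * ⟪v, μ⟫ + F.logPartition θ := by
    rw [← Real.exp_eq_exp, Real.exp_add, hF.exp_logPartition hmem, hF.exp_logPartition hθ,
      integral_congr_ae hexp, integral_const_mul]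
  refine withDensity_congr_ae ?_
  filter_upwards [hexp] with x hx
  rw [density_eq, density_eq, hx, hk, ← mul_assoc, ← Real.exp_add]
  ring_nf

/-- On a compact set of base points, the Bregman divergence grows at least quadratically near the
base point and at least linearly away from it. -/
theorem IsRegular.exists_le_bregman (hF : F.IsRegular)
    {K : Set (EuclideanSpace ℝ (Fin k) × EuclideanSpace ℝ (Fin k))} (hK : IsCompact K)
    (hKΘ : ∀ p ∈ K, p.1 ∈ F.Θ ∧ F.mean p.1 = p.2) :
    ∃ c > 0, ∀ p ∈ K, ∀ θ ∈ F.Θ,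
      c * min (‖θ - p.1‖ ^ 2) ‖θ - p.1‖ ≤ F.bregman p.1 θ := by
  obtain ⟨c, hc, hcK⟩ : ∃ c > 0, ∀ p ∈ K, ∀ v : EuclideanSpace ℝ (Fin k), ‖v‖ = 1 →
      c ≤ F.spread p.1 p.2 v := by
    -- Carrying the mean as a second coordinate of `K` avoids having to prove that `mean` is
    -- continuous.
    have hcont : ContinuousOn (fun q : (EuclideanSpace ℝ (Fin k) × EuclideanSpace ℝ (Fin k)) ×
        EuclideanSpace ℝ (Fin k) => F.spread q.1.1 q.1.2 q.2)
        (K ×ˢ Metric.sphere 0 1) := by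
      intro q hq
      have h1 := hF.continuousAt_spread (hKΘ _ hq.1).1 q.1.2 q.2
      have h2 : ContinuousAt (fun q : (EuclideanSpace ℝ (Fin k) × EuclideanSpace ℝ (Fin k)) ×
        EuclideanSpace ℝ (Fin k) => (q.1.1, q.1.2, q.2)) q := Continuous.continuousAt (by fun_prop)
      exact (ContinuousAt.comp (f := fun q : (EuclideanSpace ℝ (Fin k) ×
        EuclideanSpace ℝ (Fin k)) × EuclideanSpace ℝ (Fin k) => (q.1.1, q.1.2, q.2))
        h1 h2).continuousWithinAt
    rcases (K ×ˢ Metric.sphere (0 : EuclideanSpace ℝ (Fin k)) 1).eq_empty_or_nonempty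
      with he | hne
    · refine ⟨1, one_pos, fun p hp v hv => ?_⟩
      have : (p, v) ∈ K ×ˢ Metric.sphere (0 : EuclideanSpace ℝ (Fin k)) 1 :=
        ⟨hp, by simpa using hv⟩
      simp [he] at this
    · obtain ⟨q, hq, hmin⟩ := (hK.prod (isCompact_sphere _ _)).exists_isMinOn hne hcont
      refine ⟨F.spread q.1.1 q.1.2 q.2, hF.spread_pos (hKΘ _ hq.1).1 _ ?_, fun p hp v hv => ?_⟩
      · exact norm_ne_zero_iff.1 (by rw [mem_sphere_zero_iff_norm.1 hq.2]; exact one_ne_zero)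
      · exact isMinOn_iff.1 hmin (p, v) (Set.mk_mem_prod hp (mem_sphere_zero_iff_norm.2 hv))
  refine ⟨c / 8, by positivity, ?_⟩
  have hnear (p) (hp : p ∈ K) (θ) (hθ : θ ∈ F.Θ) (hle : ‖θ - p.1‖ ≤ 1) :
      c / 8 * ‖θ - p.1‖ ^ 2 ≤ F.bregman p.1 θ := by
    rcases eq_or_ne (θ - p.1) 0 with h0 | h0
    · simpa [h0] using hF.bregman_nonneg (hKΘ p hp).1 hθ
    have hn : 0 < ‖θ - p.1‖ := norm_pos_iff.2 h0
    have h1 := hcK p hp (‖θ - p.1‖⁻¹ • (θ - p.1)) (by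
      rw [norm_smul, norm_inv, norm_norm]
      exact inv_mul_cancel₀ hn.ne')
    -- For `n ≤ 1`, `n² min(y², 1) ≤ min((n y)², 1)`, which reduces to unit directions.
    have h2 : ‖θ - p.1‖ ^ 2 * F.spread p.1 p.2 (‖θ - p.1‖⁻¹ • (θ - p.1)) ≤
        F.spread p.1 p.2 (θ - p.1) := by
      rw [spread, spread, ← integral_const_mul]
      refine integral_mono ((hF.integrable_min (hKΘ p hp).1 _ _).const_mul _)
        (hF.integrable_min (hKΘ p hp).1 _ _) fun x => ?_
      simp only [real_inner_smul_left]
      refine le_min ?_ ?_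
      · calc _ ≤ ‖θ - p.1‖ ^ 2 * (‖θ - p.1‖⁻¹ * ⟪θ - p.1, F.s x - p.2⟫) ^ 2 := by
              gcongr
              exact min_le_left _ _
          _ = _ := by field_simp
      · exact mul_le_one₀ (pow_le_one₀ hn.le hle) (by positivity) (min_le_right _ _)
    have h3 := hF.spread_le_bregman (hKΘ p hp).1 hθ
    rw [(hKΘ p hp).2] at h3
    nlinarith [sq_nonneg ‖θ - p.1‖]
  intro p hp θ hθ
  rcases le_total ‖θ - p.1‖ 1 with hle | hge
  · exact (mul_le_mul_of_nonneg_left (min_le_left _ _) (by positivity)).trans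
      (hnear p hp θ hθ hle)
  refine (mul_le_mul_of_nonneg_left (min_le_right _ _) (by positivity)).trans ?_
  have hn : 0 < ‖θ - p.1‖ := zero_lt_one.trans_le hge
  -- Far from the base point, convexity compares `θ` with the point at distance 1 on the same ray:
  -- the divergence there is at most `n⁻¹` times that at `θ`.
  set n := ‖θ - p.1‖ with hndef
  have hp1 := (hKΘ p hp).1
  have hab : 1 - n⁻¹ + n⁻¹ = 1 := by ring
  have hinv : n⁻¹ ≤ 1 := inv_le_one_of_one_le₀ hge
  have hsub : (1 - n⁻¹) • p.1 + n⁻¹ • θ - p.1 = n⁻¹ • (θ - p.1) := by module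
  have hmem := hF.convex hp1 hθ (sub_nonneg.2 hinv) (by positivity) hab
  have hnorm : ‖(1 - n⁻¹) • p.1 + n⁻¹ • θ - p.1‖ = 1 := by
    rw [hsub, norm_smul, norm_inv, ← hndef, Real.norm_of_nonneg hn.le, inv_mul_cancel₀ hn.ne']
  have h1 := hnear p hp _ hmem hnorm.le
  have h2 := hF.convexOn_logPartition.2 hp1 hθ (sub_nonneg.2 hinv) (by positivity) hab
  rw [hnorm] at h1
  have h3 : F.bregman p.1 ((1 - n⁻¹) • p.1 + n⁻¹ • θ) ≤ n⁻¹ * F.bregman p.1 θ := by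
    rw [bregman, bregman, hsub, real_inner_smul_right]
    simp only [smul_eq_mul] at h2
    linarith
  have h4 := mul_le_mul_of_nonneg_left (h1.trans h3) hn.le
  rw [mul_inv_cancel_left₀ hn.ne'] at h4
  linarith

/-! ### Continuity of the mean parametrization -/

theorem bregman_add_bregman (F : ExpFamily d k) (θ θ' : EuclideanSpace ℝ (Fin k)) :
    F.bregman θ θ' + F.bregman θ' θ = ⟪F.mean θ' - F.mean θ, θ' - θ⟫ := by
  simp only [bregman, inner_sub_left, inner_sub_right]
  ring

/-- The natural parameter with a given mean. -/
noncomputable def ofMean (F : ExpFamily d k) (μ : EuclideanSpace ℝ (Fin k)) :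
    EuclideanSpace ℝ (Fin k) :=
  Classical.epsilon fun θ => θ ∈ F.Θ ∧ μ = F.mean θ

theorem ofMean_spec {μ : EuclideanSpace ℝ (Fin k)} (hμ : μ ∈ F.momentSpace) :
    F.ofMean μ ∈ F.Θ ∧ F.mean (F.ofMean μ) = μ := by
  have := Classical.epsilon_spec (p := fun θ => θ ∈ F.Θ ∧ μ = F.mean θ) hμ
  exact ⟨this.1, this.2.symm⟩

/-- The symmetrized divergence is at most `‖μ - μ₀‖ n` with `n` the distance of the parameters, and
at least `c min(n², n)`; so close means force close parameters. -/
theorem IsRegular.continuousOn_ofMean (hF : F.IsRegular) :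
    ContinuousOn F.ofMean F.momentSpace := by
  intro μ₀ hμ₀
  obtain ⟨h0, hm0⟩ := ofMean_spec hμ₀
  obtain ⟨c, hc, hbd⟩ := hF.exists_le_bregman (K := {(F.ofMean μ₀, μ₀)}) isCompact_singleton
    (by rintro p rfl; exact ⟨h0, hm0⟩)
  rw [Metric.continuousWithinAt_iff]
  intro ε hε
  refine ⟨c * min ε 1, by positivity, fun μ hμ hdist => ?_⟩
  obtain ⟨h1, hm1⟩ := ofMean_spec hμ
  rw [dist_eq_norm] at hdist ⊢
  have h2 := hbd _ rfl _ h1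
  have h3 := hF.bregman_nonneg h1 h0
  have h4 := F.bregman_add_bregman (F.ofMean μ₀) (F.ofMean μ)
  rw [hm0, hm1] at h4
  have h5 := real_inner_le_norm (μ - μ₀) (F.ofMean μ - F.ofMean μ₀)
  simp only at h2
  by_contra! hcon
  set n := ‖F.ofMean μ - F.ofMean μ₀‖
  have hn : 0 < n := hε.trans_le hcon
  have h6 : n * min ε 1 ≤ min (n ^ 2) n := by
    refine le_min ?_ (mul_le_of_le_one_right hn.le (min_le_right _ _))
    rw [sq]
    exact mul_le_mul_of_nonneg_left ((min_le_left _ _).trans hcon) hn.le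
  have h7 := mul_le_mul_of_nonneg_left h6 hc.le
  have h8 := mul_lt_mul_of_pos_right hdist hn
  linarith

end ExpFamily

/-! ### Uniform Laplace bounds -/

theorem integrable_exp_neg_mul_norm {E : Type*} [NormedAddCommGroup E] [NormedSpace ℝ E]
    [FiniteDimensional ℝ E] [MeasurableSpace E] [BorelSpace E] (μ : Measure E)
    [μ.IsAddHaarMeasure] {b : ℝ} (hb : 0 < b) :
    Integrable (fun x : E => Real.exp (-b * ‖x‖)) μ := by
  set m := Module.finrank ℝ E + 1 with hm
  have hint := (integrable_one_add_norm (μ := μ) (E := E) (r := (m : ℝ))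
    (by rw [hm]; push_cast; linarith)).const_mul (Real.exp b * (m.factorial / b ^ m))
  refine hint.mono' (by fun_prop) (.of_forall fun x => ?_)
  rw [Real.norm_eq_abs, Real.abs_exp, Real.rpow_neg (by positivity), Real.rpow_natCast,
    ← div_eq_mul_inv, le_div_iff₀ (by positivity)]
  have h := Real.pow_div_factorial_le_exp (b * (1 + ‖x‖)) (by positivity) m
  rw [div_le_iff₀ (by positivity), mul_pow] at h
  calc Real.exp (-b * ‖x‖) * (1 + ‖x‖) ^ m
      = Real.exp (-b * ‖x‖) * (b ^ m * (1 + ‖x‖) ^ m) / b ^ m := by field_simp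
    _ ≤ Real.exp (-b * ‖x‖) * (Real.exp (b * (1 + ‖x‖)) * m.factorial) / b ^ m := by gcongr
    _ = Real.exp (-b * ‖x‖ + b * (1 + ‖x‖)) * m.factorial / b ^ m := by
        rw [Real.exp_add]; ring
    _ = _ := by
        rw [show -b * ‖x‖ + b * (1 + ‖x‖) = b by ring]; ring

theorem exists_lintegral_exp_neg_min_le {k : ℕ} {c T₀ : ℝ} (hc : 0 < c) (hT₀ : 0 < T₀) :
    ∃ C > 0, ∀ T, T₀ ≤ T → ∀ θ₀ : EuclideanSpace ℝ (Fin k),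
      ∫⁻ θ, ENNReal.ofReal (Real.exp (-(T * (c * min (‖θ - θ₀‖ ^ 2) ‖θ - θ₀‖)))) ≤
        ENNReal.ofReal (C * (√T ^ k)⁻¹) := by
  set a := √T₀ with ha
  have hapos : 0 < a := Real.sqrt_pos.2 hT₀
  have hint := integrable_exp_neg_mul_norm (volume : Measure (EuclideanSpace ℝ (Fin k)))
    (mul_pos hc hapos)
  refine ⟨Real.exp (c * a ^ 2) * ∫ w : EuclideanSpace ℝ (Fin k), Real.exp (-(c * a) * ‖w‖),
    mul_pos (Real.exp_pos _) (integral_exp_pos hint), fun T hT θ₀ => ?_⟩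
  have hTpos := hT₀.trans_le hT
  have hs : 0 < √T := Real.sqrt_pos.2 hTpos
  have has : a ≤ √T := Real.sqrt_le_sqrt hT
  have hsq : √T ^ 2 = T := Real.sq_sqrt hTpos.le
  rw [lintegral_sub_right_eq_self (fun v : EuclideanSpace ℝ (Fin k) =>
    ENNReal.ofReal (Real.exp (-(T * (c * min (‖v‖ ^ 2) ‖v‖)))))]
  have hle (v : EuclideanSpace ℝ (Fin k)) : Real.exp (-(T * (c * min (‖v‖ ^ 2) ‖v‖))) ≤
      Real.exp (c * a ^ 2) * Real.exp (-(c * a) * ‖√T • v‖) := by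
    rw [← Real.exp_add, norm_smul, Real.norm_of_nonneg hs.le]
    refine Real.exp_le_exp.2 ?_
    -- Both regimes are dominated by one exponential in `√T ‖v‖`: the quadratic one through `a y -
    -- a² ≤ y²`, the linear one through `a ≤ √T`. Rescaling by `√T` then yields the factor
    -- `T^(-k/2)`.
    have hkey : a * (√T * ‖v‖) - a ^ 2 ≤ T * min (‖v‖ ^ 2) ‖v‖ := by
      rcases min_choice (‖v‖ ^ 2) ‖v‖ with h | h <;> rw [h]
      · rw [show T * ‖v‖ ^ 2 = (√T * ‖v‖) ^ 2 by rw [mul_pow, hsq]]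
        nlinarith [sq_nonneg (a - √T * ‖v‖), sq_nonneg a, sq_nonneg (√T * ‖v‖)]
      · nth_rw 2 [← hsq]
        have := mul_le_mul_of_nonneg_right has (mul_nonneg hs.le (norm_nonneg v))
        nlinarith [sq_nonneg a]
    have := mul_le_mul_of_nonneg_left hkey hc.le
    linarith
  have hscaled : Integrable (fun v : EuclideanSpace ℝ (Fin k) =>
      Real.exp (c * a ^ 2) * Real.exp (-(c * a) * ‖√T • v‖)) :=
    (hint.comp_smul hs.ne').const_mul _
  refine (lintegral_mono fun v => ENNReal.ofReal_le_ofReal (hle v)).trans ?_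
  rw [← ofReal_integral_eq_lintegral_ofReal hscaled (.of_forall fun _ => by positivity),
    integral_const_mul, Measure.integral_comp_smul volume
      (fun w : EuclideanSpace ℝ (Fin k) => Real.exp (-(c * a) * ‖w‖)) √T]
  refine ENNReal.ofReal_le_ofReal (le_of_eq ?_)
  rw [finrank_euclideanSpace_fin, abs_of_pos (by positivity), smul_eq_mul]
  ring

namespace ExpFamily

variable {d k : ℕ} {F : ExpFamily d k}

/-- The value at `u` of the convex conjugate of the log-partition function. -/
noncomputable def conjugate (F : ExpFamily d k) (u : EuclideanSpace ℝ (Fin k)) : ℝ :=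
  ⟪u, F.ofMean u⟫ - F.logPartition (F.ofMean u)

theorem inner_sub_logPartition_eq {u : EuclideanSpace ℝ (Fin k)} (hu : u ∈ F.momentSpace)
    (θ : EuclideanSpace ℝ (Fin k)) :
    ⟪u, θ⟫ - F.logPartition θ = F.conjugate u - F.bregman (F.ofMean u) θ := by
  rw [conjugate, bregman, (ofMean_spec hu).2, inner_sub_right]
  ring

theorem IsRegular.inner_sub_logPartition_le (hF : F.IsRegular) {u : EuclideanSpace ℝ (Fin k)}
    (hu : u ∈ F.momentSpace) {θ : EuclideanSpace ℝ (Fin k)} (hθ : θ ∈ F.Θ) :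
    ⟪u, θ⟫ - F.logPartition θ ≤ F.conjugate u := by
  rw [inner_sub_logPartition_eq hu]
  linarith [hF.bregman_nonneg (ofMean_spec hu).1 hθ]

theorem IsRegular.exists_lintegral_le (hF : F.IsRegular) {U : Set (EuclideanSpace ℝ (Fin k))}
    (hU : IsCompact U) (hUM : U ⊆ F.momentSpace) {T₀ : ℝ} (hT₀ : 0 < T₀) :
    ∃ C > 0, ∀ T, T₀ ≤ T → ∀ u ∈ U,
      ∫⁻ θ in F.Θ, ENNReal.ofReal (Real.exp (T * (⟪u, θ⟫ - F.logPartition θ))) ≤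
        ENNReal.ofReal (C * (√T ^ k)⁻¹ * Real.exp (T * F.conjugate u)) := by
  obtain ⟨c, hc, hbd⟩ := hF.exists_le_bregman (K := (fun u => (F.ofMean u, u)) '' U)
    (hU.image_of_continuousOn ((hF.continuousOn_ofMean.mono hUM).prodMk continuousOn_id))
    (by rintro _ ⟨u, hu, rfl⟩; exact ofMean_spec (hUM hu))
  obtain ⟨C, hC, hCT⟩ := exists_lintegral_exp_neg_min_le (k := k) hc hT₀
  refine ⟨C, hC, fun T hT u hu => ?_⟩
  have hTpos := hT₀.trans_le hT
  calc ∫⁻ θ in F.Θ, ENNReal.ofReal (Real.exp (T * (⟪u, θ⟫ - F.logPartition θ)))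
      ≤ ∫⁻ θ in F.Θ, ENNReal.ofReal (Real.exp (T * F.conjugate u)) * ENNReal.ofReal
          (Real.exp (-(T * (c * min (‖θ - F.ofMean u‖ ^ 2) ‖θ - F.ofMean u‖)))) := by
        refine setLIntegral_mono' hF.isOpen.measurableSet fun θ hθ => ?_
        rw [← ENNReal.ofReal_mul (Real.exp_nonneg _), ← Real.exp_add,
          inner_sub_logPartition_eq (hUM hu)]
        refine ENNReal.ofReal_le_ofReal (Real.exp_le_exp.2 ?_)
        have := mul_le_mul_of_nonneg_left (hbd _ (Set.mem_image_of_mem _ hu) θ hθ) hTpos.le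
        simp only at this
        linarith
    _ = ENNReal.ofReal (Real.exp (T * F.conjugate u)) * ∫⁻ θ in F.Θ, ENNReal.ofReal
          (Real.exp (-(T * (c * min (‖θ - F.ofMean u‖ ^ 2) ‖θ - F.ofMean u‖)))) :=
        lintegral_const_mul' _ _ ENNReal.ofReal_ne_top
    _ ≤ ENNReal.ofReal (Real.exp (T * F.conjugate u)) * ENNReal.ofReal (C * (√T ^ k)⁻¹) := by
        gcongr
        exact (setLIntegral_le_lintegral _ _).trans (hCT T hT _)
    _ = _ := by rw [← ENNReal.ofReal_mul (Real.exp_nonneg _), mul_comm]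

theorem IsRegular.exists_le_lintegral (hF : F.IsRegular) {U : Set (EuclideanSpace ℝ (Fin k))}
    (hU : IsCompact U) (hUM : U ⊆ F.momentSpace) {W : EuclideanSpace ℝ (Fin k) → ℝ}
    (hW : ContinuousOn W F.Θ) :
    ∃ c > 0, ∀ T, 1 ≤ T → ∀ u ∈ U,
      ENNReal.ofReal (c * (√T ^ k)⁻¹ * Real.exp (T * F.conjugate u)) ≤
        ∫⁻ θ in F.Θ, ENNReal.ofReal (Real.exp (T * (⟪u, θ⟫ - F.logPartition θ) + W θ)) := by
  have hK : IsCompact (F.ofMean '' U) :=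
    hU.image_of_continuousOn (hF.continuousOn_ofMean.mono hUM)
  obtain ⟨r, hr, hsub, C, hC, hbd⟩ := hF.exists_bregman_le hK
    (by rintro _ ⟨u, hu, rfl⟩; exact (ofMean_spec (hUM hu)).1)
  obtain ⟨M, hM⟩ := (hK.cthickening (r := r)).exists_bound_of_continuousOn (hW.mono hsub)
  set V := (volume (Metric.ball (0 : EuclideanSpace ℝ (Fin k)) 1)).toReal with hV
  have hVpos : 0 < V := ENNReal.toReal_pos (Metric.measure_ball_pos _ _ one_pos).ne'
    measure_ball_lt_top.ne
  -- Restrict to the ball of radius `r / √T` about `ofMean u`: there `T` times the divergence is at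
  -- most `C r²`, `W ≥ -M`, and the volume is `r^k V / √T^k`.
  refine ⟨Real.exp (-(C * r ^ 2 + M)) * (r ^ k * V), by positivity, fun T hT u hu => ?_⟩
  have hTpos := zero_lt_one.trans_le hT
  have hs : 1 ≤ √T := Real.one_le_sqrt.2 hT
  have hspos : 0 < √T := zero_lt_one.trans_le hs
  have hrs : r / √T ≤ r := div_le_self hr.le hs
  have hball : Metric.ball (F.ofMean u) (r / √T) ⊆ Metric.cthickening r (F.ofMean '' U) :=
    ((Metric.ball_subset_ball hrs).trans Metric.ball_subset_closedBall).trans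
      (Metric.closedBall_subset_cthickening (Set.mem_image_of_mem _ hu) r)
  calc ENNReal.ofReal (Real.exp (-(C * r ^ 2 + M)) * (r ^ k * V) * (√T ^ k)⁻¹ *
        Real.exp (T * F.conjugate u))
      = ENNReal.ofReal (Real.exp (T * F.conjugate u - (C * r ^ 2 + M))) *
          volume (Metric.ball (F.ofMean u) (r / √T)) := by
        rw [Measure.addHaar_ball_of_pos volume _ (by positivity), finrank_euclideanSpace_fin,
          ← ENNReal.ofReal_toReal (a := volume (Metric.ball (0 : EuclideanSpace ℝ (Fin k)) 1))
            measure_ball_lt_top.ne, ← hV, ← ENNReal.ofReal_mul (by positivity),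
          ← ENNReal.ofReal_mul (Real.exp_nonneg _), div_pow, sub_eq_add_neg, Real.exp_add]
        congr 1
        field_simp
    _ = ∫⁻ θ in Metric.ball (F.ofMean u) (r / √T),
          ENNReal.ofReal (Real.exp (T * F.conjugate u - (C * r ^ 2 + M))) := by
        rw [setLIntegral_const]
    _ ≤ ∫⁻ θ in Metric.ball (F.ofMean u) (r / √T),
          ENNReal.ofReal (Real.exp (T * (⟪u, θ⟫ - F.logPartition θ) + W θ)) := by
        refine setLIntegral_mono' measurableSet_ball fun θ hθ => ?_
        refine ENNReal.ofReal_le_ofReal (Real.exp_le_exp.2 ?_)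
        have h1 := (abs_le.1 (hM θ (hball hθ))).1
        have hn := (mem_ball_iff_norm.1 hθ).le
        have h2 := hbd _ (Set.mem_image_of_mem _ hu) θ (hn.trans hrs)
        have h3 : T * (C * ‖θ - F.ofMean u‖ ^ 2) ≤ C * r ^ 2 := by
          calc T * (C * ‖θ - F.ofMean u‖ ^ 2) ≤ T * (C * (r / √T) ^ 2) := by gcongr
            _ = C * r ^ 2 := by
              rw [div_pow, Real.sq_sqrt hTpos.le]
              field_simp
        have h4 := mul_le_mul_of_nonneg_left h2 hTpos.le
        rw [inner_sub_logPartition_eq (hUM hu)]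
        linarith
    _ ≤ _ := lintegral_mono_set (hball.trans hsub)

/-! ### Marginals and the ratio bound -/

/-- The unnormalized posterior density is an exponential tilt of the prior. -/
theorem marginal_eq (F : ExpFamily d k) (hΘ : MeasurableSet F.Θ) (ξ : EuclideanSpace ℝ (Fin k))
    (ν : ℝ) {n : ℕ} (x : Fin n → F.carrier) (J : Finset (Fin n)) :
    F.marginal ξ ν x J = ENNReal.ofReal (Real.exp (-(F.psi ξ ν).toReal)) *
      ∫⁻ θ in F.Θ, ENNReal.ofReal (Real.exp
        (⟪ξ + ∑ j ∈ J, F.s (x j), θ⟫ - (ν + J.card) * F.logPartition θ)) := by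
  rw [marginal, ← lintegral_const_mul' _ _ ENNReal.ofReal_ne_top]
  refine setLIntegral_congr_fun hΘ fun θ hθ => ?_
  simp only [prior, if_pos hθ, density, ← Real.exp_sum]
  rw [← ENNReal.ofReal_mul (Real.exp_nonneg _), ← Real.exp_add, ← Real.exp_add,
    Finset.sum_sub_distrib, ← inner_sum, inner_add_left, real_inner_comm θ (∑ j ∈ J, F.s (x j)),
    Finset.sum_const, nsmul_eq_mul]
  simp only [logPartition]
  ring_nf

end ExpFamily

theorem mainTheorem9 {d k : ℕ} (F : ExpFamily d k) (ξ : EuclideanSpace ℝ (Fin k)) (ν : ℝ)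
    (hF : F.WellBehaved ξ ν) (U : Set (EuclideanSpace ℝ (Fin k))) (hU : IsCompact U)
    (hUM : U ⊆ F.momentSpace) :
    ∃ C : ℝ, 0 < C ∧
      ∀ n : ℕ, 1 ≤ n → ∀ A B : Finset (Fin n), B = Finset.univ \ A → A.Nonempty → B.Nonempty →
        ∀ x : Fin n → F.carrier,
          (A.card : ℝ)⁻¹ • ∑ j ∈ A, F.s (x j) ∈ U →
          F.posteriorMean ξ ν x B ∈ U →
          (0 < F.marginal ξ ν x A ∧ F.marginal ξ ν x A < ⊤) ∧
          (0 < F.marginal ξ ν x B ∧ F.marginal ξ ν x B < ⊤) ∧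
          F.marginal ξ ν x Finset.univ / (F.marginal ξ ν x A * F.marginal ξ ν x B) ≤
            ENNReal.ofReal (C *
              (((ν + (A.card : ℝ)) * (ν + (B.card : ℝ))) / (ν + (n : ℝ))) ^ ((k : ℝ) / 2)) := by
  obtain ⟨hR, hν, hξ⟩ := hF
  simp only at hν hξ
  have hW : ContinuousOn (fun θ => ⟪ξ, θ⟫ - ν * F.logPartition θ) F.Θ :=
    (Continuous.continuousOn (by fun_prop)).sub (hR.continuousOn_logPartition.const_mul ν)
  obtain ⟨c₁, hc₁, hlowA⟩ := hR.exists_le_lintegral hU hUM hW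
  obtain ⟨c₂, hc₂, hlowB⟩ := hR.exists_le_lintegral hU hUM (W := fun _ => 0) continuousOn_const
  obtain ⟨C₁, hC₁, hup⟩ := hR.exists_lintegral_le hU hUM one_pos
  -- Integrability of the unnormalized prior, used only for the finiteness of `m(x_A)`.
  obtain ⟨C₀, -, hup₀⟩ := hR.exists_lintegral_le isCompact_singleton
    (Set.singleton_subset_iff.2 hξ) hν
  set e := Real.exp (-(F.psi ξ ν).toReal) with he
  have hepos : 0 < e := Real.exp_pos _
  clear_value e
  -- The prior constant `e` occurs once in the numerator and twice in the denominator; `√2 ^ k`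
  -- comes from the weight `(p + b) / 2`.
  refine ⟨C₁ * √2 ^ k / (e * c₁ * c₂), by positivity, ?_⟩
  intro n _ A B hB hA hBne x hxA hxB
  have hdisj : Disjoint A B := hB ▸ Finset.disjoint_sdiff
  have hunion : A ∪ B = Finset.univ := hB ▸ Finset.union_sdiff_of_subset (Finset.subset_univ A)
  have hcard : (n : ℝ) = A.card + B.card := by
    have := Finset.card_union_of_disjoint hdisj
    rw [hunion, Finset.card_univ, Fintype.card_fin] at this
    exact_mod_cast this
  have hsumn : ∑ j, F.s (x j) = ∑ j ∈ A, F.s (x j) + ∑ j ∈ B, F.s (x j) := by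
    rw [← hunion, Finset.sum_union hdisj]
  have hp : (1 : ℝ) ≤ A.card := by exact_mod_cast hA.card_pos
  have hq : (1 : ℝ) ≤ B.card := by exact_mod_cast hBne.card_pos
  set p : ℝ := (A.card : ℝ) with hpA
  set b : ℝ := ν + (B.card : ℝ) with hb
  have hb1 : 1 ≤ b := by linarith
  set u := p⁻¹ • ∑ j ∈ A, F.s (x j) with hu
  set w := F.posteriorMean ξ ν x B with hw
  have hup' : ∑ j ∈ A, F.s (x j) = p • u := by
    rw [hu, smul_inv_smul₀ (by positivity)]
  have hwb : ξ + ∑ j ∈ B, F.s (x j) = b • w := by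
    rw [hw, ExpFamily.posteriorMean, smul_inv_smul₀ (zero_lt_one.trans_le hb1).ne']
  clear_value p b u w
  have hmA : F.marginal ξ ν x A = ENNReal.ofReal e * ∫⁻ θ in F.Θ, ENNReal.ofReal
      (Real.exp (p * (⟪u, θ⟫ - F.logPartition θ) + (⟪ξ, θ⟫ - ν * F.logPartition θ))) := by
    rw [F.marginal_eq hR.isOpen.measurableSet, hup', ← he, ← hpA]
    simp only [inner_add_left, real_inner_smul_left]
    congr 1
    refine lintegral_congr fun θ => ?_
    congr 2
    ring
  have hmB : F.marginal ξ ν x B = ENNReal.ofReal e * ∫⁻ θ in F.Θ, ENNReal.ofReal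
      (Real.exp (b * (⟪w, θ⟫ - F.logPartition θ))) := by
    rw [F.marginal_eq hR.isOpen.measurableSet, hwb, ← he, ← hb]
    simp only [real_inner_smul_left, mul_sub]
  have hmn : F.marginal ξ ν x Finset.univ = ENNReal.ofReal e * ∫⁻ θ in F.Θ, ENNReal.ofReal
      (Real.exp (p * (⟪u, θ⟫ - F.logPartition θ) + b * (⟪w, θ⟫ - F.logPartition θ))) := by
    rw [F.marginal_eq hR.isOpen.measurableSet, hsumn, add_left_comm, hwb, hup', Finset.card_univ,
      Fintype.card_fin, hcard, ← he]
    simp only [inner_add_left, real_inner_smul_left, hb]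
    congr 1
    refine lintegral_congr fun θ => ?_
    congr 2
    ring
  have hAlow := hlowA p hp u hxA
  have hBlow := hlowB b hb1 w hxB
  simp only [add_zero] at hBlow
  have hsp : 0 < √p := Real.sqrt_pos.2 (by linarith)
  have hsb : 0 < √b := Real.sqrt_pos.2 (by linarith)
  have hAlow' : ENNReal.ofReal (e * (c₁ * (√p ^ k)⁻¹ * Real.exp (p * F.conjugate u))) ≤
      F.marginal ξ ν x A := by
    rw [hmA, ENNReal.ofReal_mul hepos.le]
    gcongr
  have hBlow' : ENNReal.ofReal (e * (c₂ * (√b ^ k)⁻¹ * Real.exp (b * F.conjugate w))) ≤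
      F.marginal ξ ν x B := by
    rw [hmB, ENNReal.ofReal_mul hepos.le]
    gcongr
  have hApos : 0 < F.marginal ξ ν x A :=
    (ENNReal.ofReal_pos.2 (by positivity)).trans_le hAlow'
  have hBpos : 0 < F.marginal ξ ν x B :=
    (ENNReal.ofReal_pos.2 (by positivity)).trans_le hBlow'
  have hBtop : F.marginal ξ ν x B < ⊤ := by
    rw [hmB]
    exact ENNReal.mul_lt_top ENNReal.ofReal_lt_top
      ((hup b hb1 w hxB).trans_lt ENNReal.ofReal_lt_top)
  have hAtop : F.marginal ξ ν x A < ⊤ := by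
    rw [hmA]
    refine ENNReal.mul_lt_top ENNReal.ofReal_lt_top (lt_of_le_of_lt
      (b := ENNReal.ofReal (Real.exp (p * F.conjugate u)) * ∫⁻ θ in F.Θ, ENNReal.ofReal
        (Real.exp (ν * (⟪ν⁻¹ • ξ, θ⟫ - F.logPartition θ)))) ?_ ?_)
    · rw [← lintegral_const_mul' _ _ ENNReal.ofReal_ne_top]
      refine setLIntegral_mono' hR.isOpen.measurableSet fun θ hθ => ?_
      rw [← ENNReal.ofReal_mul (Real.exp_nonneg _), ← Real.exp_add]
      have h1 := mul_le_mul_of_nonneg_left (hR.inner_sub_logPartition_le (hUM hxA) hθ)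
        (zero_le_one.trans hp)
      rw [real_inner_smul_left ξ, mul_sub ν, mul_inv_cancel_left₀ hν.ne']
      gcongr
    · exact ENNReal.mul_lt_top ENNReal.ofReal_lt_top
        ((hup₀ ν le_rfl _ rfl).trans_lt ENNReal.ofReal_lt_top)
  refine ⟨⟨hApos, hAtop⟩, ⟨hBpos, hBtop⟩, ?_⟩
  have hS : ν + n = p + b := by rw [hcard, hb]; ring
  have hSpos : 0 < p + b := by linarith
  have hsS : 0 < √((p + b) / 2) := Real.sqrt_pos.2 (by linarith)
  have hnup : F.marginal ξ ν x Finset.univ ≤ ENNReal.ofReal (e * (C₁ * (√((p + b) / 2) ^ k)⁻¹ *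
      (Real.exp (p * F.conjugate u) * Real.exp (b * F.conjugate w)))) := by
    rw [hmn, ENNReal.ofReal_mul hepos.le]
    gcongr
    -- `s` is the larger weight and keeps its Laplace decay; the factor of weight `t` is replaced by
    -- its maximum. Stated symmetrically to serve both orders of `p` and `b`.
    have hmain : ∀ s t : ℝ, 1 ≤ s → 0 ≤ t → (p + b) / 2 ≤ s → ∀ y ∈ U, ∀ z ∈ U,
        ∫⁻ θ in F.Θ, ENNReal.ofReal (Real.exp
          (s * (⟪y, θ⟫ - F.logPartition θ) + t * (⟪z, θ⟫ - F.logPartition θ))) ≤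
        ENNReal.ofReal (C₁ * (√((p + b) / 2) ^ k)⁻¹ *
          (Real.exp (s * F.conjugate y) * Real.exp (t * F.conjugate z))) := by
      intro s t hs ht hsS' y hy z hz
      calc _ ≤ ∫⁻ θ in F.Θ, ENNReal.ofReal (Real.exp (t * F.conjugate z)) *
            ENNReal.ofReal (Real.exp (s * (⟪y, θ⟫ - F.logPartition θ))) := by
            refine setLIntegral_mono' hR.isOpen.measurableSet fun θ hθ => ?_
            rw [← ENNReal.ofReal_mul (Real.exp_nonneg _), ← Real.exp_add]
            have h1 := mul_le_mul_of_nonneg_left (hR.inner_sub_logPartition_le (hUM hz) hθ) ht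
            exact ENNReal.ofReal_le_ofReal (Real.exp_le_exp.2 (by linarith))
        _ ≤ ENNReal.ofReal (Real.exp (t * F.conjugate z)) *
            ENNReal.ofReal (C₁ * (√s ^ k)⁻¹ * Real.exp (s * F.conjugate y)) := by
            rw [lintegral_const_mul' _ _ ENNReal.ofReal_ne_top]
            gcongr
            exact hup s hs y hy
        _ = ENNReal.ofReal (C₁ * (√s ^ k)⁻¹ *
            (Real.exp (s * F.conjugate y) * Real.exp (t * F.conjugate z))) := by
            rw [← ENNReal.ofReal_mul (Real.exp_nonneg _)]
            ring_nf
        _ ≤ _ := by gcongr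
    rcases le_total p b with hpb | hpb
    · have := hmain b p hb1 (by linarith) (by linarith) w hxB u hxA
      rw [mul_comm (Real.exp (b * _))] at this
      simpa only [add_comm] using this
    · exact hmain p b hp (by linarith) (by linarith) u hxA w hxB
  refine ENNReal.div_le_of_le_mul ?_
  refine hnup.trans ((mul_le_mul_right (mul_le_mul' hAlow' hBlow') _).trans' ?_)
  rw [← ENNReal.ofReal_mul (by positivity), ← ENNReal.ofReal_mul (by positivity)]
  refine ENNReal.ofReal_le_ofReal ?_
  -- Here `p = |A|` is enlarged to `a = ν + p`.
  have hpow : (√p * √b / √(p + b)) ^ k ≤ ((ν + p) * b / (ν + n)) ^ ((k : ℝ) / 2) := by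
    rw [hS, ← Real.sqrt_mul (by linarith), ← Real.sqrt_div (by nlinarith), Real.sqrt_eq_rpow,
      ← Real.rpow_natCast, ← Real.rpow_mul (by positivity), one_div_mul_eq_div]
    gcongr
    linarith
  rw [Real.sqrt_div hSpos.le]
  have hsS2 : 0 < √(p + b) := Real.sqrt_pos.2 hSpos
  calc _ = C₁ * √2 ^ k / (e * c₁ * c₂) * (√p * √b / √(p + b)) ^ k *
        (e * (c₁ * (√p ^ k)⁻¹ * Real.exp (p * F.conjugate u)) *
          (e * (c₂ * (√b ^ k)⁻¹ * Real.exp (b * F.conjugate w)))) := by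
        rw [div_pow, div_pow, mul_pow]
        field_simp
    _ ≤ _ := by gcongr
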